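/- An ET0L-system is a tuple $H=(V,\mathcal{A},\Delta,I)$, where $V$ is a finite alphabet, $\mathcal{A}\subseteq V$ is the set of terminal symbols, $\Delta$ is a finite set of tables, each table being a finite subset of $V\times V^*$, and $I\subseteq V^*$ is a finite set of axioms. An element $(c,v)$ of a table $P$ is called a rule for $c$, and by convention, if no rule for $c\in V$ is specified in $P$, then $P$ contains the rule $(c,c)$. For $u,v\in V^*$ write $u\Rightarrow_H v$ if there are a table $P\in\Delta$, letters $c_1,\dots,c_m\in V$ and words $v_1,\dots,v_m\in V^*$ with $u=c_1\cdots c_m$, $v=v_1\cdots v_m$ and $(c_j,v_j)\in P$ for all $j$; let $\Rightarrow_H^*$ be the reflexive transitive closure of $\Rightarrow_H$. The language generated by $H$ is $L(H)=\{v\in\mathcal{A}^*\mid w\Rightarrow_H^* v\text{ for some }w\in I\}$. An EDT0L-system is an ET0L-system in which each table contains exactly one rule for each letter of $V$. A language is ET0L (respectively EDT0L) if it equals $L(H)$ for some ET0L-system (respectively EDT0L-system) $H$. For a language $L\subseteq\mathcal{A}^*$ and $k\in\mathbb{N}$ let $$C^k(L)=\{w_{\sigma(1)}\cdots w_{\sigma(k)}\mid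 w_1,\dots,w_k\in\mathcal{A}^*,\ w_1\cdots w_k\in L,\ \sigma\in S_k\},$$ where $S_k$ is the group of permutations of $\{1,\dots,k\}$. **Theorem.** Let $\mathcal{A}$ be a finite alphabet, $L\subseteq\mathcal{A}^*$ and $k\in\mathbb{N}$. If $L$ is ET0L, then $C^k(L)$ is ET0L. If $L$ is EDT0L, then $C^k(L)$ is EDT0L. Consequently, if $L$ is context-free, then $C^k(L)$ is ET0L. -/

import Mathlib

universe u

/-- An ET0L-system with terminal alphabet `A`.  The inclusion of the terminal alphabet in the
alphabet `V` of all symbols is given by an injective map `A → V`. -/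
structure ET0LSystem (A : Type u) where
  /-- The alphabet of all symbols. -/
  V : Type u
  finite_V : Finite V
  /-- The inclusion of the terminal symbols. -/
  terminal : A ↪ V
  /-- The tables, each of them a set of rules `(c, v)`, read `c → v`. -/
  tables : Set (Set (V × List V))
  finite_tables : tables.Finite
  finite_table : ∀ P ∈ tables, P.Finite
  /-- The axioms. -/
  axs : Set (List V)
  finite_axs : axs.Finite

/-- `HasRule P c v` says that `c → v` is a rule of the table `P`, with the convention that a
letter `c` for which `P` specifies no rule has the single rule `c → c`. -/
def HasRule {V : Type u} (P : Set (V × List V)) (c : V) (v : List V) : Prop :=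
  (c, v) ∈ P ∨ ((∀ w : List V, (c, w) ∉ P) ∧ v = [c])

/-- Parallel rewriting with the table `P`: `u = c₁ ⋯ cₘ` is rewritten to `v = v₁ ⋯ vₘ`, where
each `cⱼ → vⱼ` is a rule of `P`. -/
def TableStep {V : Type u} (P : Set (V × List V)) (u v : List V) : Prop :=
  ∃ vs : List (List V), List.Forall₂ (HasRule P) u vs ∧ v = vs.flatten

namespace ET0LSystem

variable {A : Type u}

/-- One derivation step `u ⇒ v`: some table is applied to all the letters of `u`. -/
def Step (H : ET0LSystem A) (u v : List H.V) : Prop :=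
  ∃ P ∈ H.tables, TableStep P u v

/-- `u ⇒* v`: derivation in finitely many (possibly zero) steps. -/
def Derives (H : ET0LSystem A) : List H.V → List H.V → Prop :=
  Relation.ReflTransGen H.Step

/-- The language generated by `H`: the terminal words derivable from an axiom. -/
def language (H : ET0LSystem A) : Language A :=
  { v : List A | ∃ w ∈ H.axs, H.Derives w (v.map H.terminal) }

/-- An EDT0L-system is an ET0L-system where each table has exactly one rule for each letter. -/
def IsDeterministic (H : ET0LSystem A) : Prop :=
  ∀ P ∈ H.tables, ∀ c : H.V, ∃! v : List H.V, HasRule P c v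

end ET0LSystem

/-- A language is ET0L if some ET0L-system generates it. -/
def IsET0L {A : Type u} (L : Language A) : Prop :=
  ∃ H : ET0LSystem A, H.language = L

/-- A language is EDT0L if some EDT0L-system generates it. -/
def IsEDT0L {A : Type u} (L : Language A) : Prop :=
  ∃ H : ET0LSystem A, H.IsDeterministic ∧ H.language = L

/-- `C^k(L)`: the words `w_{σ(1)} ⋯ w_{σ(k)}` with `w₁ ⋯ w_k ∈ L` and `σ` a permutation of the
`k` indices; the factors `wᵢ` may be empty. -/
def factorPermutations {A : Type u} (k : ℕ) (L : Language A) : Language A :=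
  { x : List A | ∃ (w : Fin k → List A) (σ : Equiv.Perm (Fin k)),
      (List.ofFn w).flatten ∈ L ∧ x = (List.ofFn fun i => w (σ i)).flatten }

/-! Fix a derivation of a word cut into k factors. Each letter occurrence in it derives a subword
that reaches from some factor p to some factor q; annotate it with the span (p, q). The new system
carries k copies of the annotated word side by side, in the order given by σ. Copy i keeps only the
letters with p ≤ i ≤ q and ends up producing the i-th factor. Spans and σ are guessed in the axioms,
and spans are refined in the rules.

The copies have to make the same choices. A letter with p = q lives in one copy, so any rule may be
applied to it. A letter with p < q lives in several copies, but in a correctly spanned word it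
occurs at most once; so each new table can fix one annotated right-hand side per such letter without
losing derivations. There are finitely many such choices, and determinism of the tables survives. A
last table turns terminals with p = q into true terminals and everything else into a dead symbol.

`exists_tableStep_factorCopy` lifts a step to the copies and `exists_isSpanned_of_tableStep`
projects it back; `language_factorSystem` combines them. Context-free languages reduce to the ET0L
case through `language_toET0LSystem`. -/

section TableStep

/-! ### Parallel rewriting by one table. -/

variable {V : Type u} {P : Set (V × List V)}

theorem exists_hasRule (P : Set (V × List V)) (c : V) : ∃ v, HasRule P c v := by
  by_cases h : ∃ v, (c, v) ∈ P
  · exact h.imp fun v hv => Or.inl hv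
  · exact ⟨[c], Or.inr ⟨not_exists.1 h, rfl⟩⟩

theorem finite_setOf_hasRule (hP : P.Finite) (c : V) : {v | HasRule P c v}.Finite := by
  refine ((hP.image Prod.snd).union (Set.finite_singleton [c])).subset ?_
  rintro v (h | ⟨-, h⟩)
  · exact Or.inl ⟨_, h, rfl⟩
  · exact Or.inr h

@[simp]
theorem tableStep_nil_iff {v : List V} : TableStep P [] v ↔ v = [] := by
  simp [TableStep]

theorem tableStep_cons_iff {c : V} {u v : List V} :
    TableStep P (c :: u) v ↔ ∃ a b, HasRule P c a ∧ TableStep P u b ∧ v = a ++ b := by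
  constructor
  · rintro ⟨vs, h, rfl⟩
    cases h with
    | cons h₁ h₂ => exact ⟨_, _, h₁, ⟨_, h₂, rfl⟩, rfl⟩
  · rintro ⟨a, b, h, ⟨vs, hvs, rfl⟩, rfl⟩
    exact ⟨a :: vs, .cons h hvs, rfl⟩

@[simp]
theorem tableStep_singleton_iff {c : V} {v : List V} : TableStep P [c] v ↔ HasRule P c v := by
  simp [tableStep_cons_iff]

theorem tableStep_append_iff {u₁ u₂ v : List V} :
    TableStep P (u₁ ++ u₂) v ↔
      ∃ v₁ v₂, TableStep P u₁ v₁ ∧ TableStep P u₂ v₂ ∧ v = v₁ ++ v₂ := by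
  induction u₁ generalizing v with
  | nil => simp
  | cons c u ih =>
    simp only [List.cons_append, tableStep_cons_iff, ih]
    constructor
    · rintro ⟨a, _, ha, ⟨b, d, hb, hd, rfl⟩, rfl⟩
      exact ⟨a ++ b, d, ⟨a, b, ha, hb, rfl⟩, hd, by simp⟩
    · rintro ⟨_, d, ⟨a, b, ha, hb, rfl⟩, hd, rfl⟩
      exact ⟨a, b ++ d, ha, ⟨b, d, hb, hd, rfl⟩, by simp⟩

theorem TableStep.append {u₁ u₂ v₁ v₂ : List V} (h₁ : TableStep P u₁ v₁)
    (h₂ : TableStep P u₂ v₂) : TableStep P (u₁ ++ u₂) (v₁ ++ v₂) :=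
  tableStep_append_iff.2 ⟨_, _, h₁, h₂, rfl⟩

theorem tableStep_self {u : List V} (h : ∀ c ∈ u, HasRule P c [c]) : TableStep P u u := by
  induction u with
  | nil => simp
  | cons c u ih =>
    exact tableStep_cons_iff.2 ⟨[c], u, h c (by simp), ih fun d hd => h d (by simp [hd]), rfl⟩

theorem tableStep_flatMap {ι : Type*} {l : List ι} {f g : ι → List V}
    (h : ∀ i ∈ l, TableStep P (f i) (g i)) : TableStep P (l.flatMap f) (l.flatMap g) := by
  induction l with
  | nil => simp
  | cons i l ih =>
    exact (h i (by simp)).append (ih fun j hj => h j (by simp [hj]))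

/-- Without repeated indices the pieces of the result can be stored as a function of the index. -/
theorem TableStep.exists_flatMap {ι : Type*} {l : List ι} (hl : l.Nodup) {f : ι → List V}
    {v : List V} (h : TableStep P (l.flatMap f) v) :
    ∃ g : ι → List V, (∀ i ∈ l, TableStep P (f i) (g i)) ∧ v = l.flatMap g := by
  classical
  induction l generalizing v with
  | nil => exact ⟨fun _ => [], by simp, by simpa using h⟩
  | cons i l ih =>
    obtain ⟨a, b, ha, hb, rfl⟩ := tableStep_append_iff.1 h
    obtain ⟨hi, hl⟩ := List.nodup_cons.1 hl
    obtain ⟨g, hg, rfl⟩ := ih hl hb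
    have key : ∀ j ∈ l, Function.update g i a j = g j := fun j hj =>
      Function.update_of_ne (by rintro rfl; exact hi hj) _ _
    refine ⟨Function.update g i a, ?_, ?_⟩
    · intro j hj
      rcases List.mem_cons.1 hj with rfl | hj
      · simpa using ha
      · rw [key j hj]; exact hg j hj
    · simp only [List.flatMap_cons, Function.update_self]
      congr 1
      exact (List.flatMap_congr key).symm

/-- The table with the rules `c → v` for `v ∈ R c`. -/
def ruleTable (R : V → Set (List V)) : Set (V × List V) :=
  {x | x.2 ∈ R x.1}

theorem finite_ruleTable [Finite V] {R : V → Set (List V)} (hR : ∀ c, (R c).Finite) :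
    (ruleTable R).Finite := by
  refine (Set.finite_iUnion fun c => (hR c).image (Prod.mk c)).subset ?_
  rintro ⟨c, v⟩ h
  exact Set.mem_iUnion.2 ⟨c, v, h, rfl⟩

theorem hasRule_ruleTable_iff {R : V → Set (List V)} (hR : ∀ c, (R c).Nonempty) {c : V}
    {v : List V} : HasRule (ruleTable R) c v ↔ v ∈ R c := by
  constructor
  · rintro (h | ⟨h, -⟩)
    · exact h
    · exact absurd (hR c).choose_spec (h _)
  · exact Or.inl

end TableStep

/-! ### Context-free languages are ET0L. -/

section ContextFree

variable {A : Type u}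

namespace ContextFreeGrammar

variable (g : ContextFreeGrammar A)

/-- The nonterminals that occur in the rules of a grammar, together with its initial symbol. -/
def usedNonterminals : Set g.NT :=
  {n | n = g.initial ∨ ∃ r ∈ g.rules, n = r.input ∨ Symbol.nonterminal n ∈ r.output}

/-- The nonterminal type of a grammar may be infinite, whereas the alphabet of an ET0L-system must
be finite. -/
theorem finite_usedNonterminals : g.usedNonterminals.Finite := by
  have h : ∀ r : ContextFreeRule A g.NT,
      {n | n = r.input ∨ Symbol.nonterminal n ∈ r.output}.Finite := fun r =>
    (Set.finite_singleton r.input).union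
      (r.output.finite_toSet.preimage fun _ _ _ _ h => Symbol.nonterminal.inj h)
  refine ((Set.finite_singleton g.initial).union
    (g.rules.finite_toSet.biUnion fun r _ => h r)).subset ?_
  rintro n (hn | ⟨r, hr, hn⟩)
  · exact Or.inl hn
  · exact Or.inr (Set.mem_biUnion hr hn)

/-- The symbols of a grammar that can occur in sentential forms. -/
abbrev UsedSymbol : Type u :=
  A ⊕ ULift.{u} g.usedNonterminals

/-- The inclusion of the used symbols in all symbols. -/
def UsedSymbol.toSymbol : g.UsedSymbol → Symbol A g.NT
  | .inl a => .terminal a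
  | .inr n => .nonterminal n.down

theorem UsedSymbol.toSymbol_injective : Function.Injective (UsedSymbol.toSymbol g) := by
  rintro (a | ⟨n, _⟩) (b | ⟨m, _⟩) h <;> simp_all [UsedSymbol.toSymbol]

/-- The table with the rules of a grammar and the identical rules. -/
def table : Set (g.UsedSymbol × List g.UsedSymbol) :=
  {x | x.2 = [x.1] ∨ ∃ r ∈ g.rules, UsedSymbol.toSymbol g x.1 = .nonterminal r.input ∧
    x.2.map (UsedSymbol.toSymbol g) = r.output}

theorem hasRule_table_iff {c : g.UsedSymbol} {v : List g.UsedSymbol} :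
    HasRule g.table c v ↔ (c, v) ∈ g.table := by
  constructor
  · rintro (h | ⟨-, h⟩)
    · exact h
    · exact Or.inl h
  · exact Or.inl

theorem finite_table [Finite A] : g.table.Finite := by
  have := g.finite_usedNonterminals.to_subtype
  have h₁ : (Set.range fun c : g.UsedSymbol => (c, [c])).Finite := Set.finite_range _
  have h₂ : {x : g.UsedSymbol × List g.UsedSymbol | ∃ r ∈ g.rules,
      (UsedSymbol.toSymbol g x.1, x.2.map (UsedSymbol.toSymbol g)) =
        (Symbol.nonterminal r.input, r.output)}.Finite := by
    refine ((g.rules.finite_toSet.image fun r => (Symbol.nonterminal r.input, r.output)).preimage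
      (f := Prod.map (UsedSymbol.toSymbol g) (List.map (UsedSymbol.toSymbol g)))
      ((UsedSymbol.toSymbol_injective g).prodMap
        (UsedSymbol.toSymbol_injective g).list_map).injOn).subset ?_
    rintro x ⟨r, hr, h⟩
    exact ⟨r, hr, h.symm⟩
  refine (h₁.union h₂).subset ?_
  rintro ⟨c, v⟩ (h | ⟨r, hr, h, h'⟩)
  · exact Or.inl ⟨c, Prod.ext rfl h.symm⟩
  · exact Or.inr ⟨r, hr, Prod.ext h h'⟩

/-- The ET0L-system with the same language as a context-free grammar. -/
def toET0LSystem [Finite A] : ET0LSystem A where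
  V := g.UsedSymbol
  finite_V := by
    have := g.finite_usedNonterminals.to_subtype
    infer_instance
  terminal := ⟨Sum.inl, Sum.inl_injective⟩
  tables := {g.table}
  finite_tables := Set.finite_singleton _
  finite_table := by
    rintro _ rfl
    exact g.finite_table
  axs := {[.inr ⟨g.initial, Or.inl rfl⟩]}
  finite_axs := Set.finite_singleton _

variable {g}

theorem derives_of_tableStep {u v : List g.UsedSymbol} (h : TableStep g.table u v) :
    g.Derives (u.map (UsedSymbol.toSymbol g)) (v.map (UsedSymbol.toSymbol g)) := by
  induction u generalizing v with
  | nil => rw [tableStep_nil_iff.1 h]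
  | cons c u ih =>
    obtain ⟨a, b, ha, hb, rfl⟩ := tableStep_cons_iff.1 h
    have h₁ : g.Derives [UsedSymbol.toSymbol g c] (a.map (UsedSymbol.toSymbol g)) := by
      rcases g.hasRule_table_iff.1 ha with h | ⟨r, hr, h, h'⟩
      · dsimp only at h
        subst h
        exact .refl _
      · dsimp only at h h'
        rw [h, h']
        exact .single ⟨r, hr, ContextFreeRule.Rewrites.input_output⟩
    simpa using (h₁.append_right _).trans ((ih hb).append_left _)

/-- The identical rules let a parallel step rewrite one occurrence and leave all others alone. -/
theorem exists_tableStep_of_produces {u : List g.UsedSymbol} {y : List (Symbol A g.NT)}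
    (h : g.Produces (u.map (UsedSymbol.toSymbol g)) y) :
    ∃ v, y = v.map (UsedSymbol.toSymbol g) ∧ TableStep g.table u v := by
  obtain ⟨r, hr, h⟩ := h
  obtain ⟨p, q, hu, rfl⟩ := h.exists_parts
  obtain ⟨u₁, u₂, rfl, h₁, rfl⟩ := List.map_eq_append_iff.1 hu
  obtain ⟨u₀, u₁, rfl, rfl, hc⟩ := List.map_eq_append_iff.1 h₁
  obtain ⟨c, rfl, hc⟩ := List.map_eq_singleton_iff.1 hc
  have self : ∀ w : List g.UsedSymbol, TableStep g.table w w := fun w =>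
    tableStep_self fun c _ => g.hasRule_table_iff.2 (Or.inl rfl)
  obtain ⟨a, ha⟩ : ∃ a : List g.UsedSymbol, a.map (UsedSymbol.toSymbol g) = r.output := by
    have : r.output ∈ Set.range (List.map (UsedSymbol.toSymbol g)) := by
      rw [Set.range_list_map]
      rintro (b | n) hs
      · exact ⟨.inl b, rfl⟩
      · exact ⟨.inr ⟨n, Or.inr ⟨r, hr, Or.inr hs⟩⟩, rfl⟩
    exact this
  refine ⟨u₀ ++ a ++ u₂, by simp [ha], ((self u₀).append ?_).append (self u₂)⟩
  rw [tableStep_singleton_iff, hasRule_table_iff]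
  exact Or.inr ⟨r, hr, List.singleton_inj.1 hc, ha⟩

theorem language_toET0LSystem [Finite A] (g : ContextFreeGrammar A) :
    g.toET0LSystem.language = g.language := by
  have term : ∀ v : List A, List.map (UsedSymbol.toSymbol g) (v.map g.toET0LSystem.terminal) =
      v.map Symbol.terminal := fun v => List.map_map
  ext v
  constructor
  · rintro ⟨_, rfl, h⟩
    rw [mem_language_iff, ← term v]
    have key : ∀ w : List g.UsedSymbol,
        g.toET0LSystem.Derives [.inr ⟨g.initial, Or.inl rfl⟩] w →
          g.Derives [.nonterminal g.initial] (w.map (UsedSymbol.toSymbol g)) := by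
      intro w hw
      induction hw with
      | refl => exact .refl _
      | tail _ h ih =>
        obtain ⟨_, rfl, h⟩ := h
        exact ih.trans (derives_of_tableStep h)
    exact key _ h
  · intro h
    rw [mem_language_iff] at h
    have key : ∀ y, g.Derives [.nonterminal g.initial] y →
        ∃ w, y = w.map (UsedSymbol.toSymbol g) ∧
          g.toET0LSystem.Derives [.inr ⟨g.initial, Or.inl rfl⟩] w := by
      intro y hy
      induction hy with
      | refl => exact ⟨_, rfl, .refl⟩
      | tail _ h ih =>
        obtain ⟨w, rfl, hw⟩ := ih
        obtain ⟨w', rfl, hw'⟩ := exists_tableStep_of_produces h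
        exact ⟨w', rfl, hw.tail ⟨_, rfl, hw'⟩⟩
    obtain ⟨w, hw, hd⟩ := key _ h
    rw [← term v] at hw
    rw [← (UsedSymbol.toSymbol_injective g).list_map hw] at hd
    exact ⟨_, rfl, hd⟩

end ContextFreeGrammar

theorem Language.IsContextFree.isET0L [Finite A] {L : Language A} (hL : L.IsContextFree) :
    IsET0L L := by
  obtain ⟨g, rfl⟩ := hL
  exact ⟨g.toET0LSystem, g.language_toET0LSystem⟩

end ContextFree

/-! ### Spanned words and the system for permuted factors. -/

section FactorSystem

variable {A V : Type u} {k : ℕ}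

/-- A letter `c` together with two indices `p` and `q`, standing for an occurrence of `c` that
derives a word reaching from the factor with index `p` to the factor with index `q`. -/
abbrev SpanLetter (V : Type u) (k : ℕ) : Type u :=
  V × Fin k × Fin k

/-- The spans of the letters of `W` follow each other between the indices `p` and `q`. -/
def IsSpanned : Fin k → Fin k → List (SpanLetter V k) → Prop
  | p, q, [] => p ≤ q
  | p, q, x :: W => p ≤ x.2.1 ∧ x.2.1 ≤ x.2.2 ∧ IsSpanned x.2.2 q W

namespace IsSpanned

theorem le {p q : Fin k} {W : List (SpanLetter V k)} (h : IsSpanned p q W) : p ≤ q := by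
  induction W generalizing p with
  | nil => exact h
  | cons x W ih => exact h.1.trans (h.2.1.trans (ih h.2.2))

theorem mono_left {p p' q : Fin k} {W : List (SpanLetter V k)} (h : IsSpanned p q W)
    (hp : p' ≤ p) : IsSpanned p' q W := by
  cases W with
  | nil => exact hp.trans h
  | cons x W => exact ⟨hp.trans h.1, h.2⟩

/-- Gaps between consecutive spans are allowed, so the cut index r need not be unique. -/
theorem append_iff {p q : Fin k} {W₁ W₂ : List (SpanLetter V k)} :
    IsSpanned p q (W₁ ++ W₂) ↔ ∃ r, IsSpanned p r W₁ ∧ IsSpanned r q W₂ := by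
  induction W₁ generalizing p with
  | nil => exact ⟨fun h => ⟨p, le_refl p, h⟩, fun ⟨r, h, h'⟩ => h'.mono_left h⟩
  | cons x W ih =>
    simp only [List.cons_append, IsSpanned, ih]
    constructor
    · rintro ⟨h, h', r, h₁, h₂⟩; exact ⟨r, ⟨h, h', h₁⟩, h₂⟩
    · rintro ⟨r, ⟨h, h', h₁⟩, h₂⟩; exact ⟨h, h', r, h₁, h₂⟩

theorem bounds {p q : Fin k} {W : List (SpanLetter V k)} (h : IsSpanned p q W)
    {x : SpanLetter V k} (hx : x ∈ W) : p ≤ x.2.1 ∧ x.2.1 ≤ x.2.2 ∧ x.2.2 ≤ q := by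
  induction W generalizing p with
  | nil => simp at hx
  | cons y W ih =>
    rcases List.mem_cons.1 hx with rfl | hx
    · exact ⟨h.1, h.2.1, h.2.2.le⟩
    · obtain ⟨h₁, h₂⟩ := ih h.2.2 hx
      exact ⟨h.1.trans (h.2.1.trans h₁), h₂⟩

end IsSpanned

/-- All letters of `v` lie in the factor with index `p`. -/
def pureSpan (p : Fin k) (v : List V) : List (SpanLetter V k) :=
  v.map fun c => (c, p, p)

@[simp]
theorem map_fst_pureSpan (p : Fin k) (v : List V) : (pureSpan p v).map Prod.fst = v := by
  simp [pureSpan, Function.comp_def]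

theorem isSpanned_pureSpan (p : Fin k) (v : List V) : IsSpanned p p (pureSpan p v) := by
  induction v with
  | nil => exact le_refl p
  | cons c v ih => exact ⟨le_refl p, le_refl p, ih⟩

theorem eq_pureSpan {p : Fin k} {W : List (SpanLetter V k)} (h : IsSpanned p p W) :
    W = pureSpan p (W.map Prod.fst) := by
  rw [pureSpan, List.map_map]
  refine (List.map_id W).symm.trans (List.map_congr_left fun x hx => ?_)
  obtain ⟨h₁, h₂, h₃⟩ := h.bounds hx
  exact Prod.ext rfl (Prod.ext (le_antisymm (h₂.trans h₃) h₁) (le_antisymm h₃ (h₁.trans h₂)))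

/-- The symbols of the system for the permuted factors: terminal letters, a dead symbol, and
spanned letters in the copy that belongs to a factor. -/
abbrev FactorSymbol (A V : Type u) (k : ℕ) : Type u :=
  Option A ⊕ (SpanLetter V k × Fin k)

/-- The part of a spanned word that contributes to the factor with index `i`. -/
def factorCopy (A : Type u) (i : Fin k) (W : List (SpanLetter V k)) :
    List (FactorSymbol A V k) :=
  W.flatMap fun x => if x.2.1 ≤ i ∧ i ≤ x.2.2 then [Sum.inr (x, i)] else []

@[simp]
theorem factorCopy_nil (i : Fin k) :
    factorCopy A i ([] : List (SpanLetter V k)) = [] := rfl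

@[simp]
theorem factorCopy_append (i : Fin k) (W₁ W₂ : List (SpanLetter V k)) :
    factorCopy A i (W₁ ++ W₂) = factorCopy A i W₁ ++ factorCopy A i W₂ :=
  List.flatMap_append

theorem factorCopy_cons (i : Fin k) (x : SpanLetter V k) (W : List (SpanLetter V k)) :
    factorCopy A i (x :: W) = factorCopy A i [x] ++ factorCopy A i W :=
  factorCopy_append i [x] W

theorem factorCopy_singleton (i : Fin k) (x : SpanLetter V k) :
    factorCopy A i [x] = if x.2.1 ≤ i ∧ i ≤ x.2.2 then [Sum.inr (x, i)] else [] := by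
  simp [factorCopy]

theorem factorCopy_flatMap {ι : Type*} (i : Fin k) (l : List ι)
    (f : ι → List (SpanLetter V k)) :
    factorCopy A i (l.flatMap f) = l.flatMap fun j => factorCopy A i (f j) :=
  List.flatMap_assoc

theorem factorCopy_eq_nil {p q i : Fin k} {W : List (SpanLetter V k)} (hW : IsSpanned p q W)
    (hi : ¬ (p ≤ i ∧ i ≤ q)) : factorCopy A i W = [] := by
  refine List.flatMap_eq_nil_iff.2 fun x hx => if_neg fun h => hi ?_
  obtain ⟨h₁, -, h₃⟩ := hW.bounds hx
  exact ⟨h₁.trans h.1, h.2.trans h₃⟩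

theorem factorCopy_pureSpan (i p : Fin k) (v : List V) :
    factorCopy A i (pureSpan p v) =
      if i = p then v.map (fun c => Sum.inr ((c, p, p), p)) else [] := by
  split_ifs with h
  · subst h
    induction v with
    | nil => rfl
    | cons c v ih =>
      rw [List.map_cons, ← ih, pureSpan, List.map_cons, factorCopy_cons, factorCopy_singleton]
      simp [pureSpan]
  · exact factorCopy_eq_nil (isSpanned_pureSpan p v) fun h' => h (le_antisymm h'.2 h'.1)

/-- The spanned right-hand sides of the rules for a letter with a proper span. -/
def spanRules (P : Set (V × List V)) (x : SpanLetter V k) : Set (List (SpanLetter V k)) :=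
  {W | (x.2.1 < x.2.2 → HasRule P x.1 (W.map Prod.fst) ∧ IsSpanned x.2.1 x.2.2 W) ∧
    (¬ x.2.1 < x.2.2 → W = [])}

/-- A word of length n has only finitely many annotations, one for each vector of n index pairs. -/
theorem finite_setOf_map_fst_mem {S : Set (List V)} (hS : S.Finite) :
    {W : List (SpanLetter V k) | W.map Prod.fst ∈ S}.Finite := by
  refine hS.preimage' fun v _ => ?_
  have h : (Set.range fun t : List.Vector (Fin k × Fin k) v.length =>
      v.zip t.toList).Finite := Set.finite_range _
  refine h.subset ?_
  rintro W rfl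
  refine ⟨⟨W.map Prod.snd, by simp⟩, ?_⟩
  exact (List.zip_of_prod rfl rfl).symm

/-- Where the span is not proper, `factorRules` ignores the choice; the default `[]` is just a
placeholder. -/
theorem finite_spanRules {P : Set (V × List V)} (hP : P.Finite) (x : SpanLetter V k) :
    (spanRules P x).Finite := by
  by_cases h : x.2.1 < x.2.2
  · exact (finite_setOf_map_fst_mem (finite_setOf_hasRule hP x.1)).subset fun W hW => (hW.1 h).1
  · exact (Set.finite_singleton []).subset fun W hW => hW.2 h

theorem exists_mem_spanRules (P : Set (V × List V)) (x : SpanLetter V k) :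
    (spanRules P x).Nonempty := by
  by_cases h : x.2.1 < x.2.2
  · obtain ⟨v, hv⟩ := exists_hasRule P x.1
    refine ⟨pureSpan x.2.2 v, fun _ => ⟨by simpa using hv, ?_⟩, fun h' => absurd h h'⟩
    exact (isSpanned_pureSpan _ v).mono_left h.le
  · exact ⟨[], fun h' => absurd h' h, fun _ => rfl⟩

/-- The choices of a spanned rule of `P` for each letter with a proper span. -/
def spanChoices (P : Set (V × List V)) (k : ℕ) :
    Set (SpanLetter V k → List (SpanLetter V k)) :=
  {f | ∀ x, f x ∈ spanRules P x}

/-- The right-hand sides for a symbol: letters with a proper span are rewritten by the choice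
`f`, the other spanned letters by all rules of `P`. -/
def factorRules (P : Set (V × List V)) (f : SpanLetter V k → List (SpanLetter V k)) :
    FactorSymbol A V k → Set (List (FactorSymbol A V k))
  | .inl y => {[.inl y]}
  | .inr (x, i) => if x.2.1 < x.2.2 then {factorCopy A i (f x)}
      else (fun v => factorCopy A i (pureSpan x.2.1 v)) '' {v | HasRule P x.1 v}

theorem finite_factorRules {P : Set (V × List V)} (hP : P.Finite)
    (f : SpanLetter V k → List (SpanLetter V k)) (c : FactorSymbol A V k) :
    (factorRules P f c).Finite := by
  rcases c with y | ⟨x, i⟩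
  · exact Set.finite_singleton _
  · rw [factorRules]
    split_ifs
    · exact Set.finite_singleton _
    · exact (finite_setOf_hasRule hP x.1).image _

theorem exists_mem_factorRules (P : Set (V × List V))
    (f : SpanLetter V k → List (SpanLetter V k)) (c : FactorSymbol A V k) :
    (factorRules P f c).Nonempty := by
  rcases c with y | ⟨x, i⟩
  · exact Set.singleton_nonempty _
  · rw [factorRules]
    split_ifs
    · exact Set.singleton_nonempty _
    · exact Set.Nonempty.image _ (exists_hasRule P x.1)

/-- The table given by a table `P` and a choice `f` of spanned rules. -/
def factorTable (A : Type u) (P : Set (V × List V))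
    (f : SpanLetter V k → List (SpanLetter V k)) :
    Set (FactorSymbol A V k × List (FactorSymbol A V k)) :=
  ruleTable (factorRules P f)

@[simp]
theorem hasRule_factorTable_iff {P : Set (V × List V)}
    {f : SpanLetter V k → List (SpanLetter V k)} {c : FactorSymbol A V k}
    {v : List (FactorSymbol A V k)} :
    HasRule (factorTable A P f) c v ↔ v ∈ factorRules P f c :=
  hasRule_ruleTable_iff (exists_mem_factorRules P f)

open Classical in
/-- The final rewriting: terminal letters in a single factor become terminal symbols, all other
letters die. -/
noncomputable def finishSymbol (t : A ↪ V) : FactorSymbol A V k → FactorSymbol A V k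
  | .inl y => .inl y
  | .inr (x, _) => if h : x.2.1 = x.2.2 ∧ ∃ a, t a = x.1 then .inl (some h.2.choose)
      else .inl none

theorem finishSymbol_terminal (t : A ↪ V) (a : A) (p i : Fin k) :
    finishSymbol t (.inr ((t a, p, p), i)) = .inl (some a) := by
  simp [finishSymbol]

theorem exists_of_finishSymbol_eq {t : A ↪ V} {x : SpanLetter V k} {i : Fin k} {a : A}
    (h : finishSymbol t (.inr (x, i)) = .inl (some a)) : x = (t a, x.2.1, x.2.1) := by
  rw [finishSymbol] at h
  split_ifs at h with h'
  swap
  · simp at h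
  simp only [Sum.inl.injEq, Option.some.injEq] at h
  rw [← h]
  exact Prod.ext h'.2.choose_spec.symm (Prod.ext rfl h'.1.symm)

/-- The table of the final rewriting. -/
def finishTable (t : A ↪ V) (k : ℕ) : Set (FactorSymbol A V k × List (FactorSymbol A V k)) :=
  ruleTable fun c => {[finishSymbol t c]}

@[simp]
theorem hasRule_finishTable_iff {t : A ↪ V} {c : FactorSymbol A V k}
    {v : List (FactorSymbol A V k)} :
    HasRule (finishTable t k) c v ↔ v = [finishSymbol t c] :=
  hasRule_ruleTable_iff fun _ => Set.singleton_nonempty _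

theorem tableStep_finishTable_iff {t : A ↪ V} {u v : List (FactorSymbol A V k)} :
    TableStep (finishTable t k) u v ↔ v = u.map (finishSymbol t) := by
  induction u generalizing v with
  | nil => simp
  | cons c u ih => simp [tableStep_cons_iff, ih]

/-- Concatenation of the copies of a spanned word in the order given by a permutation. -/
def permutedCopies (A : Type u) (σ : Equiv.Perm (Fin k)) (W : List (SpanLetter V k)) :
    List (FactorSymbol A V k) :=
  (List.finRange k).flatMap fun j => factorCopy A (σ j) W

/-- The system for the permuted factors of the words of a system. -/
def ET0LSystem.factorSystem [Finite A] (H : ET0LSystem A) (m : ℕ) : ET0LSystem A where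
  V := FactorSymbol A H.V (m + 1)
  finite_V := by
    have := H.finite_V
    infer_instance
  terminal := ⟨fun a => .inl (some a), fun a b h => by simpa using h⟩
  tables := insert (finishTable H.terminal (m + 1))
    (⋃ P ∈ H.tables, factorTable A P '' spanChoices P (m + 1))
  finite_tables := by
    have := H.finite_V
    refine (H.finite_tables.biUnion fun P hP => Set.Finite.image _ ?_).insert _
    exact Set.Finite.pi' fun x => finite_spanRules (H.finite_table P hP) x
  finite_table := by
    have := H.finite_V
    rintro _ (rfl | hP)
    · exact finite_ruleTable fun _ => Set.finite_singleton _
    · obtain ⟨P, hPH, f, -, rfl⟩ := Set.mem_iUnion₂.1 hP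
      exact finite_ruleTable (finite_factorRules (H.finite_table P hPH) f)
  axs := ⋃ σ : Equiv.Perm (Fin (m + 1)), permutedCopies A σ ''
    {W | W.map Prod.fst ∈ H.axs ∧ IsSpanned 0 (Fin.last m) W}
  finite_axs := Set.finite_iUnion fun _ =>
    ((finite_setOf_map_fst_mem H.finite_axs).subset fun _ h => h.1).image _

/-- The guessing of spans is moved into the choice of table: once f is fixed, a proper span leaves
one rule, and the other spanned letters inherit uniqueness from P. -/
theorem ET0LSystem.IsDeterministic.factorSystem [Finite A] {H : ET0LSystem A}
    (hH : H.IsDeterministic) (m : ℕ) : (H.factorSystem m).IsDeterministic := by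
  rintro _ (rfl | hP) c
  · exact ⟨_, hasRule_finishTable_iff.2 rfl, fun v hv => hasRule_finishTable_iff.1 hv⟩
  · obtain ⟨P, hPH, f, -, rfl⟩ := Set.mem_iUnion₂.1 hP
    refine (existsUnique_congr fun v => hasRule_factorTable_iff).2 ?_
    rcases c with y | ⟨x, i⟩
    · exact ⟨_, rfl, fun v hv => hv⟩
    · rw [factorRules]
      split_ifs
      · exact ⟨_, rfl, fun v hv => hv⟩
      · obtain ⟨v, hv, huniq⟩ := hH P hPH x.1
        refine ⟨_, ⟨v, hv, rfl⟩, ?_⟩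
        rintro _ ⟨w, hw, rfl⟩
        rw [huniq w hw]

end FactorSystem

/-! ### Regrouping a sorted list by its keys. -/

section ListLemmas

variable {α ι : Type*}

theorem List.filter_append_filter_not_of_pairwise [LinearOrder ι] {key : α → ι} {W : List α}
    (hW : W.Pairwise fun x y => key x ≤ key y) {i : ι} (hi : ∀ x ∈ W, i ≤ key x) :
    W.filter (fun x => key x = i) ++ W.filter (fun x => key x ≠ i) = W := by
  induction W with
  | nil => rfl
  | cons x W ih =>
    obtain ⟨hx, hW⟩ := List.pairwise_cons.1 hW
    by_cases h : key x = i
    · simpa [h] using ih hW fun y hy => hi y (by simp [hy])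
    · have hlt : ∀ y ∈ W, key y ≠ i := fun y hy =>
        (((hi x (by simp)).lt_of_ne (Ne.symm h)).trans_le (hx y hy)).ne'
      have h₁ : W.filter (fun x => key x = i) = [] := by simpa using hlt
      have h₂ : W.filter (fun x => key x ≠ i) = W := by simpa using hlt
      rw [List.filter_cons_of_neg (by simpa using h), List.filter_cons_of_pos (by simpa using h),
        h₁, h₂, List.nil_append]

theorem List.flatMap_filter_key [LinearOrder ι] {key : α → ι} {l : List ι}
    (hl : l.Pairwise (· < ·)) {W : List α} (hW : W.Pairwise fun x y => key x ≤ key y)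
    (hWl : ∀ x ∈ W, key x ∈ l) : (l.flatMap fun i => W.filter fun x => key x = i) = W := by
  induction l generalizing W with
  | nil =>
    have : W = [] := List.eq_nil_iff_forall_not_mem.2 fun x hx => by simpa using hWl x hx
    simp [this]
  | cons i l ih =>
    obtain ⟨hi, hl⟩ := List.pairwise_cons.1 hl
    have hmin : ∀ x ∈ W, i ≤ key x := fun x hx => by
      rcases List.mem_cons.1 (hWl x hx) with h | h
      · exact h.ge
      · exact (hi _ h).le
    rw [List.flatMap_cons]
    conv_rhs => rw [← List.filter_append_filter_not_of_pairwise hW hmin]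
    congr 1
    rw [← ih hl (hW.filter fun x => key x ≠ i)]
    · refine List.flatMap_congr fun j hj => ?_
      rw [List.filter_filter]
      refine List.filter_congr fun x _ => ?_
      have := (hi j hj).ne'
      by_cases h : key x = j <;> simp [h, this]
    · intro x hx
      obtain ⟨hx, h⟩ := List.mem_filter.1 hx
      exact (List.mem_cons.1 (hWl x hx)).resolve_left (by simpa using h)

theorem List.flatMap_ite_eq [DecidableEq ι] {l : List ι} (hl : l.Nodup) {i : ι} (hi : i ∈ l)
    (f : ι → List α) : (l.flatMap fun j => if i = j then f j else []) = f i := by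
  induction l with
  | nil => simp at hi
  | cons j l ih =>
    obtain ⟨hj, hl⟩ := List.nodup_cons.1 hl
    rw [List.flatMap_cons]
    by_cases h : i = j
    · subst h
      rw [if_pos rfl, List.flatMap_eq_nil_iff.2, List.append_nil]
      intro j hj'
      exact if_neg (by rintro rfl; exact hj hj')
    · rw [if_neg h, List.nil_append, ih hl ((List.mem_cons.1 hi).resolve_left h)]

end ListLemmas

/-! ### Correctness of the system for permuted factors. -/

section FactorSystem

variable {A V : Type u} {k : ℕ}

theorem TableStep.mono {P Q : Set (V × List V)} {u v : List V} (h : TableStep P u v)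
    (hPQ : ∀ c ∈ u, ∀ w, HasRule P c w → HasRule Q c w) : TableStep Q u v := by
  induction u generalizing v with
  | nil => exact tableStep_nil_iff.2 (tableStep_nil_iff.1 h)
  | cons c u ih =>
    obtain ⟨a, b, ha, hb, rfl⟩ := tableStep_cons_iff.1 h
    exact tableStep_cons_iff.2 ⟨a, b, hPQ c (by simp) a ha,
      ih hb fun d hd => hPQ d (by simp [hd]), rfl⟩

theorem TableStep.eq_self {P : Set (V × List V)} {u v : List V} (h : TableStep P u v)
    (hP : ∀ c ∈ u, ∀ w, HasRule P c w → w = [c]) : v = u := by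
  induction u generalizing v with
  | nil => exact tableStep_nil_iff.1 h
  | cons c u ih =>
    obtain ⟨a, b, ha, hb, rfl⟩ := tableStep_cons_iff.1 h
    rw [hP c (by simp) a ha, ih hb fun d hd => hP d (by simp [hd]), List.singleton_append]

/-- For a proper span all copies are forced to follow the same word `f x`. For a one-point span only
one copy is nonempty, so the rule used there cannot conflict with another. -/
theorem exists_isSpanned_of_hasRule {P : Set (V × List V)}
    {f : SpanLetter V k → List (SpanLetter V k)} (hf : f ∈ spanChoices P k)
    {x : SpanLetter V k} (hx : x.2.1 ≤ x.2.2) {v : Fin k → List (FactorSymbol A V k)}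
    (hv : ∀ i, TableStep (factorTable A P f) (factorCopy A i [x]) (v i)) :
    ∃ W, IsSpanned x.2.1 x.2.2 W ∧ HasRule P x.1 (W.map Prod.fst) ∧
      ∀ i, v i = factorCopy A i W := by
  have hrule : ∀ i, x.2.1 ≤ i ∧ i ≤ x.2.2 → v i ∈ factorRules P f (.inr (x, i)) := by
    intro i hi
    have h := hv i
    rwa [factorCopy_singleton, if_pos hi, tableStep_singleton_iff, hasRule_factorTable_iff] at h
  have hout : ∀ i, ¬ (x.2.1 ≤ i ∧ i ≤ x.2.2) → v i = [] := by
    intro i hi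
    have h := hv i
    rwa [factorCopy_singleton, if_neg hi, tableStep_nil_iff] at h
  by_cases hlt : x.2.1 < x.2.2
  · obtain ⟨h₁, h₂⟩ := (hf x).1 hlt
    refine ⟨f x, h₂, h₁, fun i => ?_⟩
    by_cases hi : x.2.1 ≤ i ∧ i ≤ x.2.2
    · have h := hrule i hi
      rwa [factorRules, if_pos hlt] at h
    · rw [hout i hi, factorCopy_eq_nil h₂ hi]
  · have heq : x.2.1 = x.2.2 := hx.eq_of_not_lt hlt
    have h := hrule x.2.1 ⟨le_rfl, hx⟩
    rw [factorRules, if_neg hlt] at h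
    obtain ⟨w, hw, h⟩ := h
    have hspan : IsSpanned x.2.1 x.2.2 (pureSpan x.2.1 w) := by
      rw [← heq]
      exact isSpanned_pureSpan _ _
    refine ⟨pureSpan x.2.1 w, hspan, by simpa using hw, fun i => ?_⟩
    by_cases hi : x.2.1 ≤ i ∧ i ≤ x.2.2
    · obtain rfl : i = x.2.1 := le_antisymm (heq ▸ hi.2) hi.1
      exact h.symm
    · rw [hout i hi, factorCopy_eq_nil hspan hi]

/-- Parallel rewriting of all copies of a spanned word comes from rewriting the spanned word. -/
theorem exists_isSpanned_of_tableStep {P : Set (V × List V)}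
    {f : SpanLetter V k → List (SpanLetter V k)} (hf : f ∈ spanChoices P k) {p q : Fin k}
    {U : List (SpanLetter V k)} (hU : IsSpanned p q U) {v : Fin k → List (FactorSymbol A V k)}
    (hv : ∀ i, TableStep (factorTable A P f) (factorCopy A i U) (v i)) :
    ∃ W, IsSpanned p q W ∧ TableStep P (U.map Prod.fst) (W.map Prod.fst) ∧
      ∀ i, v i = factorCopy A i W := by
  induction U generalizing p v with
  | nil => exact ⟨[], hU, by simp, fun i => tableStep_nil_iff.1 (hv i)⟩
  | cons x U ih =>
    obtain ⟨h₁, h₂, h₃⟩ := hU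
    have hv' := fun i => tableStep_append_iff.1 (factorCopy_cons i x U ▸ hv i)
    choose a b ha hb hab using hv'
    obtain ⟨W₁, hs₁, hr₁, ha'⟩ := exists_isSpanned_of_hasRule hf h₂ ha
    obtain ⟨W₂, hs₂, hr₂, hb'⟩ := ih h₃ hb
    refine ⟨W₁ ++ W₂, IsSpanned.append_iff.2 ⟨_, hs₁.mono_left h₁, hs₂⟩, ?_, fun i => ?_⟩
    · rw [List.map_cons, List.map_append]
      exact tableStep_cons_iff.2 ⟨_, _, hr₁, hr₂, rfl⟩
    · rw [hab, ha', hb', factorCopy_append]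

/-- A rewriting step that ends in a spanned word can be lifted to all of its copies. -/
theorem exists_tableStep_factorCopy {P : Set (V × List V)} {u : List V} {p q : Fin k}
    {W : List (SpanLetter V k)} (hW : IsSpanned p q W)
    (h : TableStep P u (W.map Prod.fst)) :
    ∃ U, U.map Prod.fst = u ∧ IsSpanned p q U ∧ ∃ f ∈ spanChoices P k,
      ∀ i, TableStep (factorTable A P f) (factorCopy A i U) (factorCopy A i W) := by
  classical
  induction u generalizing p W with
  | nil =>
    obtain rfl : W = [] := by simpa using h
    exact ⟨[], rfl, hW, fun x => (exists_mem_spanRules P x).choose,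
      fun x => (exists_mem_spanRules P x).choose_spec, fun i => by simp⟩
  | cons c u ih =>
    obtain ⟨_, _, ha, hb, hab⟩ := tableStep_cons_iff.1 h
    obtain ⟨W₁, W₂, rfl, rfl, rfl⟩ := List.map_eq_append_iff.1 hab
    obtain ⟨r, hW₁, hW₂⟩ := IsSpanned.append_iff.1 hW
    obtain ⟨U, rfl, hU, f, hf, hstep⟩ := ih hW₂ hb
    have hpr : p ≤ r := hW₁.le
    -- The head letter receives the span from p to the cut r after the subword it produces; the
    -- choice for the tail must be kept on U.
    suffices hg : ∃ g ∈ spanChoices P k, (∀ y ∈ U, g y = f y) ∧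
        ∀ i, p ≤ i ∧ i ≤ r → factorCopy A i W₁ ∈ factorRules P g (.inr ((c, p, r), i)) by
      obtain ⟨g, hg, hgf, hgc⟩ := hg
      refine ⟨(c, p, r) :: U, rfl, ⟨le_rfl, hpr, hU⟩, g, hg, fun i => ?_⟩
      rw [factorCopy_cons, factorCopy_append]
      refine TableStep.append ?_ ((hstep i).mono ?_)
      · rw [factorCopy_singleton]
        split_ifs with hi
        · rw [tableStep_singleton_iff, hasRule_factorTable_iff]
          exact hgc i hi
        · rw [tableStep_nil_iff]
          exact factorCopy_eq_nil hW₁ hi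
      · intro s hs w hw
        obtain ⟨y, hy, hs⟩ := List.mem_flatMap.1 hs
        split_ifs at hs
        · obtain rfl := List.mem_singleton.1 hs
          rw [hasRule_factorTable_iff, factorRules] at hw ⊢
          rwa [hgf y hy]
        · simp at hs
    rcases hpr.lt_or_eq with hlt | rfl
    -- Overriding f here is harmless: letters of U have spans starting at r or later, and p < r, so
    -- none equals `(c, p, r)`.
    · refine ⟨Function.update f (c, p, r) W₁, fun x => ?_, fun y hy => ?_, fun i _ => ?_⟩
      · by_cases hx : x = (c, p, r)
        · subst hx
          rw [Function.update_self]
          exact ⟨fun _ => ⟨ha, hW₁⟩, fun h => absurd hlt h⟩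
        · rw [Function.update_of_ne hx]
          exact hf x
      · refine Function.update_of_ne ?_ _ _
        rintro rfl
        exact absurd (hU.bounds hy).1 (not_le.2 hlt)
      · rw [factorRules, if_pos hlt, Function.update_self]
        rfl
    · refine ⟨f, hf, fun _ _ => rfl, fun i _ => ?_⟩
      rw [factorRules, if_neg (lt_irrefl p)]
      refine ⟨_, ha, ?_⟩
      dsimp only
      rw [← eq_pureSpan hW₁]

theorem isSpanned_flatMap_pureSpan {p q : Fin k} (hpq : p ≤ q) {l : List (Fin k)}
    (hl : l.Pairwise (· < ·)) (hp : ∀ i ∈ l, p ≤ i) (hq : ∀ i ∈ l, i ≤ q)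
    (g : Fin k → List V) : IsSpanned p q (l.flatMap fun i => pureSpan i (g i)) := by
  induction l generalizing p with
  | nil => exact hpq
  | cons i l ih =>
    obtain ⟨hi, hl⟩ := List.pairwise_cons.1 hl
    exact IsSpanned.append_iff.2 ⟨i, (isSpanned_pureSpan i _).mono_left (hp i (by simp)),
      ih (hq i (by simp)) hl (fun j hj => (hi j hj).le) fun j hj => hq j (by simp [hj])⟩

theorem map_finishSymbol_permutedCopies (t : A ↪ V) (σ : Equiv.Perm (Fin k))
    {W : List (SpanLetter V k)} {w : Fin k → List A}
    (h : ∀ i, factorCopy A i W = (w i).map fun a => .inr ((t a, i, i), i)) :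
    (permutedCopies A σ W).map (finishSymbol t) =
      ((List.finRange k).flatMap fun j => w (σ j)).map fun a => .inl (some a) := by
  rw [permutedCopies, List.map_flatMap, List.map_flatMap]
  refine List.flatMap_congr fun j _ => ?_
  rw [h, List.map_map]
  exact List.map_congr_left fun a _ => finishSymbol_terminal t a _ _

/-- With one-point spans, being spanned means that the indices are weakly increasing, so collecting
the letters of each index cuts W into consecutive factors. -/
theorem IsSpanned.exists_factors {t : A ↪ V} {p q : Fin k} {W : List (SpanLetter V k)}
    (hW : IsSpanned p q W) (ht : ∀ x ∈ W, ∃ a, x = (t a, x.2.1, x.2.1)) :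
    ∃ w : Fin k → List A, W.map Prod.fst = ((List.finRange k).flatMap w).map t ∧
      ∀ i, factorCopy A i W = (w i).map fun a => .inr ((t a, i, i), i) := by
  obtain ⟨W, rfl⟩ : W ∈ Set.range
      (List.map fun y : A × Fin k => ((t y.1, y.2, y.2) : SpanLetter V k)) := by
    rw [Set.range_list_map]
    intro x hx
    obtain ⟨a, ha⟩ := ht x hx
    exact ⟨(a, x.2.1), ha.symm⟩
  refine ⟨fun i => (W.filter fun y => y.2 = i).map Prod.fst, ?_, fun i => ?_⟩
  · have hsorted : W.Pairwise fun x y => x.2 ≤ y.2 := by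
      clear ht
      induction W generalizing p with
      | nil => exact .nil
      | cons x W ih =>
        refine List.pairwise_cons.2 ⟨fun y hy => ?_, ih hW.2.2⟩
        exact (hW.2.2.bounds (List.mem_map_of_mem hy)).1
    rw [← List.map_flatMap, List.flatMap_filter_key (List.pairwise_lt_finRange k) hsorted
      (fun x _ => List.mem_finRange _), List.map_map, List.map_map]
    rfl
  · clear ht hW
    induction W with
    | nil => rfl
    | cons x W ih =>
      rw [List.map_cons, factorCopy_cons, ih, factorCopy_singleton]
      by_cases h : x.2 = i
      · subst h
        simp
      · rw [if_neg (fun h' => h (le_antisymm h'.1 h'.2)),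
          List.nil_append]
        simp [h]

theorem mem_factorPermutations_iff {L : Language A} {x : List A} :
    x ∈ factorPermutations k L ↔ ∃ (w : Fin k → List A) (σ : Equiv.Perm (Fin k)),
      (List.finRange k).flatMap w ∈ L ∧ x = (List.finRange k).flatMap fun i => w (σ i) := by
  simp only [List.flatMap_def, ← List.ofFn_eq_map]
  rfl

namespace ET0LSystem

variable [Finite A] (H : ET0LSystem A) {m : ℕ}

/-- Spans are known for the final word and pulled back through the derivation, hence the induction
from its head. The lifted steps act on each copy separately, so they serve every σ. -/
theorem exists_derives_permutedCopies {u : List H.V} {W : List (SpanLetter H.V (m + 1))}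
    (hW : IsSpanned 0 (Fin.last m) W) (h : H.Derives u (W.map Prod.fst)) :
    ∃ U, U.map Prod.fst = u ∧ IsSpanned 0 (Fin.last m) U ∧ ∀ σ,
      (H.factorSystem m).Derives (permutedCopies A σ U) (permutedCopies A σ W) := by
  induction h using Relation.ReflTransGen.head_induction_on with
  | refl => exact ⟨W, rfl, hW, fun _ => .refl⟩
  | head h _ ih =>
    obtain ⟨U, rfl, hU, hder⟩ := ih
    obtain ⟨P, hP, h⟩ := h
    obtain ⟨U', hU', hs, f, hf, hstep⟩ := exists_tableStep_factorCopy (A := A) hU h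
    refine ⟨U', hU', hs, fun σ => .head ⟨factorTable A P f, Or.inr ?_, ?_⟩ (hder σ)⟩
    · exact Set.mem_biUnion hP ⟨f, hf, rfl⟩
    · exact tableStep_flatMap fun j _ => hstep (σ j)

/-- The invariant has two phases: before the final table a step projects to a step of H; after it no
table changes anything. -/
theorem derives_factorSystem_cases {U : List (SpanLetter H.V (m + 1))}
    (hU : IsSpanned 0 (Fin.last m) U) (σ : Equiv.Perm (Fin (m + 1)))
    {y : List (FactorSymbol A H.V (m + 1))}
    (h : (H.factorSystem m).Derives (permutedCopies A σ U) y) :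
    ∃ W, IsSpanned 0 (Fin.last m) W ∧ H.Derives (U.map Prod.fst) (W.map Prod.fst) ∧
      (y = permutedCopies A σ W ∨ y = (permutedCopies A σ W).map (finishSymbol H.terminal)) := by
  induction h with
  | refl => exact ⟨U, hU, .refl, Or.inl rfl⟩
  | @tail y z _ h ih =>
    obtain ⟨W, hW, hder, hy⟩ := ih
    obtain ⟨Q, hQ, h⟩ := h
    rcases hQ with rfl | hQ
    · have hz := tableStep_finishTable_iff.1 h
      refine ⟨W, hW, hder, Or.inr ?_⟩
      rcases hy with rfl | rfl
      · exact hz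
      · rw [hz, List.map_map]
        refine List.map_congr_left fun c _ => ?_
        rcases c with c | ⟨x, i⟩
        · rfl
        · rw [Function.comp_apply, finishSymbol]
          split_ifs <;> rfl
    · obtain ⟨P, hP, f, hf, rfl⟩ := Set.mem_iUnion₂.1 hQ
      replace h : TableStep (V := FactorSymbol A H.V (m + 1)) (factorTable A P f) y z := h
      rcases hy with rfl | rfl
      · obtain ⟨g, hg, rfl⟩ := TableStep.exists_flatMap (List.nodup_finRange _) h
        -- The pieces in g are indexed by position; composing with `σ.symm` indexes them by factor.
        obtain ⟨W', hW', hstep, hg'⟩ := exists_isSpanned_of_tableStep hf hW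
          (v := fun i => g (σ.symm i)) fun i => by
            simpa using hg (σ.symm i) (List.mem_finRange _)
        refine ⟨W', hW', hder.tail ⟨P, hP, hstep⟩, Or.inl ?_⟩
        refine List.flatMap_congr fun j _ => ?_
        simpa using hg' (σ j)
      · refine ⟨W, hW, hder, Or.inr (h.eq_self ?_)⟩
        intro c hc w hw
        obtain ⟨d, -, rfl⟩ := List.mem_map.1 hc
        rw [hasRule_factorTable_iff] at hw
        rcases d with d | ⟨x, i⟩
        · exact hw
        · rw [finishSymbol] at hw ⊢
          split_ifs at hw ⊢ <;> exact hw

theorem language_factorSystem (m : ℕ) :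
    (H.factorSystem m).language = factorPermutations (m + 1) H.language := by
  ext x
  rw [mem_factorPermutations_iff]
  constructor
  · rintro ⟨u, hu, hder⟩
    obtain ⟨σ, U, ⟨hax, hU⟩, rfl⟩ := Set.mem_iUnion.1 hu
    obtain ⟨W, hW, hUW, hx⟩ := H.derives_factorSystem_cases hU σ hder
    have hx : x.map (fun a => (.inl (some a) : FactorSymbol A H.V (m + 1))) =
        (permutedCopies A σ W).map (finishSymbol H.terminal) := by
      rcases hx with hx | hx
      · rw [← hx]
        exact (List.map_map (l := x) (f := fun a => .inl (some a))
          (g := finishSymbol (k := m + 1) H.terminal)).symm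
      · exact hx
    obtain ⟨w, hw, hcopy⟩ := hW.exists_factors (t := H.terminal) fun y hy => by
      -- Every letter of W is visible in the copy of its first index, so a letter that is not
      -- terminal or has a proper span would leave a dead symbol in x.
      have hmem : finishSymbol H.terminal (.inr (y, y.2.1)) ∈
          (permutedCopies A σ W).map (finishSymbol H.terminal) := by
        refine List.mem_map_of_mem (List.mem_flatMap.2 ⟨σ.symm y.2.1, List.mem_finRange _, ?_⟩)
        refine List.mem_flatMap.2 ⟨y, hy, ?_⟩
        rw [Equiv.apply_symm_apply, if_pos ⟨le_rfl, (hW.bounds hy).2.1⟩]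
        exact List.mem_singleton_self _
      rw [← hx] at hmem
      obtain ⟨a, -, ha⟩ := List.mem_map.1 hmem
      exact ⟨a, exists_of_finishSymbol_eq ha.symm⟩
    refine ⟨w, σ, ⟨_, hax, hw ▸ hUW⟩, ?_⟩
    rw [map_finishSymbol_permutedCopies H.terminal σ hcopy] at hx
    exact List.map_injective_iff.2 (fun a b h => by simpa using h) hx
  · rintro ⟨w, σ, ⟨u, hu, hder⟩, rfl⟩
    -- The given factorization is recorded by annotating each letter of the i-th factor with (i, i).
    set W : List (SpanLetter H.V (m + 1)) :=
      (List.finRange (m + 1)).flatMap fun i => pureSpan i ((w i).map H.terminal) with hWdef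
    have hW : IsSpanned 0 (Fin.last m) W :=
      isSpanned_flatMap_pureSpan (Fin.zero_le _) (List.pairwise_lt_finRange _)
        (fun i _ => Fin.zero_le i) (fun i _ => Fin.le_last i) _
    have hfst : W.map Prod.fst = ((List.finRange (m + 1)).flatMap w).map H.terminal := by
      rw [hWdef, List.map_flatMap, List.map_flatMap]
      exact List.flatMap_congr fun i _ => map_fst_pureSpan _ _
    have hcopy : ∀ i, factorCopy A i W =
        (w i).map fun a => .inr ((H.terminal a, i, i), i) := by
      intro i
      rw [hWdef, factorCopy_flatMap]
      simp only [factorCopy_pureSpan]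
      rw [List.flatMap_ite_eq (List.nodup_finRange _) (List.mem_finRange i), List.map_map]
      rfl
    obtain ⟨U, rfl, hU, hUW⟩ := H.exists_derives_permutedCopies hW (hfst ▸ hder)
    refine ⟨permutedCopies A σ U, ?_, (hUW σ).tail ⟨finishTable H.terminal (m + 1), Or.inl rfl, ?_⟩⟩
    · exact Set.mem_iUnion.2 ⟨σ, U, ⟨hu, hU⟩, rfl⟩
    · exact tableStep_finishTable_iff.2 (map_finishSymbol_permutedCopies H.terminal σ hcopy).symm

end ET0LSystem

end FactorSystem

/-! ### The case k = 0 and the theorem. -/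

theorem isEDT0L_of_finite {A : Type u} [Finite A] {L : Language A} (hL : Set.Finite L) :
    IsEDT0L L := by
  refine ⟨⟨A, inferInstance, .refl A, ∅, Set.finite_empty, by simp, L, hL⟩, by
    rintro P ⟨⟩, ?_⟩
  ext v
  constructor
  · rintro ⟨w, hw, h⟩
    rcases Relation.ReflTransGen.cases_tail h with h | ⟨_, -, P, hP, -⟩
    · have h : v.map id = w := h
      rw [List.map_id] at h
      exact h ▸ hw
    · exact hP.elim
  · intro hv
    refine ⟨v, hv, ?_⟩
    have h : v.map (Function.Embedding.refl A) = v := List.map_id v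
    exact h.symm ▸ Relation.ReflTransGen.refl

theorem IsEDT0L.isET0L {A : Type u} {L : Language A} (hL : IsEDT0L L) : IsET0L L := by
  obtain ⟨H, -, hH⟩ := hL
  exact ⟨H, hH⟩

/-- Separate because `Fin 0` offers no endpoints for spans; only the empty word can occur. -/
theorem isEDT0L_factorPermutations_zero {A : Type u} [Finite A] (L : Language A) :
    IsEDT0L (factorPermutations 0 L) := by
  refine isEDT0L_of_finite ((Set.finite_singleton []).subset ?_)
  rintro x ⟨w, σ, -, rfl⟩
  simp

theorem IsET0L.factorPermutations {A : Type u} [Finite A] (k : ℕ) {L : Language A}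
    (hL : IsET0L L) : IsET0L (factorPermutations k L) := by
  obtain ⟨H, rfl⟩ := hL
  cases k with
  | zero => exact (isEDT0L_factorPermutations_zero _).isET0L
  | succ m => exact ⟨H.factorSystem m, H.language_factorSystem m⟩

theorem IsEDT0L.factorPermutations {A : Type u} [Finite A] (k : ℕ) {L : Language A}
    (hL : IsEDT0L L) : IsEDT0L (factorPermutations k L) := by
  obtain ⟨H, hH, rfl⟩ := hL
  cases k with
  | zero => exact isEDT0L_factorPermutations_zero _
  | succ m => exact ⟨H.factorSystem m, hH.factorSystem m, H.language_factorSystem m⟩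

theorem theorem2p3 {A : Type u} [Finite A] (k : ℕ) (L : Language A) :
    (IsET0L L → IsET0L (factorPermutations k L)) ∧
    (IsEDT0L L → IsEDT0L (factorPermutations k L)) ∧
    (L.IsContextFree → IsET0L (factorPermutations k L)) :=
  ⟨fun h => h.factorPermutations k, fun h => h.factorPermutations k,
    fun h => h.isET0L.factorPermutations k⟩
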